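/- For elements $a,b$ of a group write $[a,b]=a^{-1}b^{-1}ab$ and $b^a=a^{-1}ba$. For an integer $\alpha$ let $$J_3(\alpha)=\langle x,y \mid x^{[x,y]}=x^{\alpha},\ y^{[y,x]}=y^{\alpha},\ x^{81}=y^{81}=1\rangle,$$ and put $H_3(\alpha)=J_3(\alpha)/Z(J_3(\alpha))$ and $K_3(\alpha)=J_3(\alpha)/Z_2(J_3(\alpha))$, where $Z(T)$ and $Z_2(T)$ denote the first and second terms of the upper central series of a group $T$ (so $Z(T)$ is the center of $T$ and $Z_2(T)/Z(T)$ is the center of $T/Z(T)$). Theorem C. Let $\ell$ be an integer with $\ell\equiv -1 \pmod 3$. Then $J_3(1+3\ell)\cong J_3(7)$, $H_3(1+3\ell)\cong H_3(7)$ and $K_3(1+3\ell)\cong K_3(7)$. -/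

import Mathlib

namespace Macdonald

/-- The commutator `[a,b] = a⁻¹b⁻¹ab`. (Mathlib's `⁅a, b⁆` is `a * b * a⁻¹ * b⁻¹`.) -/
def comm {G : Type*} [Group G] (a b : G) : G := a⁻¹ * b⁻¹ * a * b

/-- The conjugate `b ^ a = a⁻¹ba`, written `conj b a`. -/
def conj {G : Type*} [Group G] (b a : G) : G := a⁻¹ * b * a

/-- The free generator `x`. -/
def x : FreeGroup (Fin 2) := FreeGroup.of 0

/-- The free generator `y`. -/
def y : FreeGroup (Fin 2) := FreeGroup.of 1

/-- Relators for `x^[x,y] = x^α`, `y^[y,x] = y^α`, `x^81 = 1`, `y^81 = 1`. -/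
def relators (α : ℤ) : Set (FreeGroup (Fin 2)) :=
  {conj x (comm x y) * (x ^ α)⁻¹, conj y (comm y x) * (y ^ α)⁻¹, x ^ 81, y ^ 81}

/-- `J₃(α) = ⟨x, y | x^[x,y] = x^α, y^[y,x] = y^α, x^81 = y^81 = 1⟩`. -/
abbrev J₃ (α : ℤ) : Type := PresentedGroup (relators α)

/-- `H₃(α) = J₃(α) / Z(J₃(α))`. -/
abbrev H₃ (α : ℤ) : Type := J₃ α ⧸ Subgroup.center (J₃ α)

/-- `K₃(α) = J₃(α) / Z₂(J₃(α))`, where `Z₂` is the second term of the upper central series. -/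
abbrev K₃ (α : ℤ) : Type := J₃ α ⧸ Subgroup.upperCentralSeries (J₃ α) 2

end Macdonald

/-! ### Normal forms from the commutator relations -/

section
variable {G : Type*} [Group G]

namespace Macdonald

/-! Write c = [a,b]. The relations say that c acts on a and on b by power maps, so every aⁱbⁿ can be
collected into the form bᵖcᵏaʲ. For α ≡ 7 mod 9, collecting a³b^αc = a³cb in two ways forces b²⁷
into the centre (`commute_pow_right`). Then, for suitable t, [a,bᵗ] is cᵗ up to a central power of
b²⁷, so (a, bᵗ) satisfies the relations for α^t (`pow_right_of_commute`). Modulo 81, every residue ≡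
7 mod 9 is such a power of 7, and t is invertible, so the change of generator can be undone. The
isomorphism carries the upper central series along, which settles the quotients. -/

/-- The pair `(a, b)` satisfies the relations of `J₃(α)`. -/
structure IsPair (α : ℤ) (a b : G) : Prop where
  left : conj a (comm a b) = a ^ α
  right : conj b (comm b a) = b ^ α
  pow_left : a ^ 81 = 1
  pow_right : b ^ 81 = 1

theorem comm_inv (a b : G) : (comm a b)⁻¹ = comm b a := by
  simp [comm, mul_assoc]

theorem pow_congr_of_pow_eq_one {g : G} {n : ℕ} (hg : g ^ n = 1) {i j : ℕ} (h : i ≡ j [MOD n]) :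
    g ^ i = g ^ j :=
  pow_eq_pow_iff_modEq.2 (h.of_dvd (orderOf_dvd_of_pow_eq_one hg))

theorem IsPair.swap {α : ℤ} {a b : G} (h : IsPair α a b) : IsPair α b a :=
  ⟨h.right, h.left, h.pow_right, h.pow_left⟩

theorem IsPair.congr {α β : ℤ} {a b : G} (h : IsPair α a b) (hαβ : α ≡ β [ZMOD 81]) :
    IsPair β a b := by
  have key : ∀ g : G, g ^ 81 = 1 → g ^ α = g ^ β := fun g hg =>
    zpow_eq_zpow_iff_modEq.2 (hαβ.of_dvd (by exact_mod_cast orderOf_dvd_of_pow_eq_one hg))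
  exact ⟨h.left.trans (key a h.pow_left), h.right.trans (key b h.pow_right),
    h.pow_left, h.pow_right⟩

/-- The sum `α + α² + ⋯ + αⁿ`. -/
def geomSum (α : ℕ) : ℕ → ℕ
  | 0 => 0
  | n + 1 => α * (geomSum α n + 1)

/-- The sum `α + α² + ⋯ + αⁿ`, reduced modulo `81` at every step. -/
def geomSumMod (α : ℕ) : ℕ → ℕ
  | 0 => 0
  | n + 1 => α * (geomSumMod α n + 1) % 81

theorem geomSumMod_modEq (α n : ℕ) : geomSumMod α n ≡ geomSum α n [MOD 81] := by
  induction n with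
  | zero => rfl
  | succ n ih => exact (Nat.mod_modEq _ _).trans ((ih.add_right 1).mul_left α)

namespace IsPair

variable {α : ℕ} {a b : G} (h : IsPair (α : ℤ) a b)
include h

theorem semiconjBy_left : a * comm a b = comm a b * a ^ α := by
  have := h.left
  rw [conj, zpow_natCast] at this
  rw [← this]; group

theorem semiconjBy_right : SemiconjBy (comm a b) b (b ^ α) := by
  have := h.right
  rw [conj, zpow_natCast, ← comm_inv] at this
  rw [SemiconjBy, ← this]; group

theorem pow_mul_comm (i : ℕ) : a ^ i * comm a b = comm a b * a ^ (α * i) := by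
  induction i with
  | zero => simp
  | succ i ih =>
    rw [pow_succ, mul_assoc, h.semiconjBy_left, ← mul_assoc, ih, mul_assoc, ← pow_add, mul_add_one]

theorem pow_mul_comm_pow (i k : ℕ) :
    a ^ i * comm a b ^ k = comm a b ^ k * a ^ (α ^ k * i) := by
  induction k with
  | zero => simp
  | succ k ih =>
    rw [pow_succ, ← mul_assoc, ih, mul_assoc, h.pow_mul_comm, ← mul_assoc, pow_succ', mul_assoc α]

theorem comm_pow_mul_pow (j k : ℕ) :
    comm a b ^ k * b ^ j = b ^ (α ^ k * j) * comm a b ^ k := by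
  induction k with
  | zero => simp
  | succ k ih =>
    rw [pow_succ', mul_assoc, ih, ← mul_assoc, (h.semiconjBy_right.pow_right _).eq, ← pow_mul,
      mul_assoc, pow_succ' α, mul_assoc α]

/-- Each a passing b leaves a factor c = [a,b] on the right; moving c left past the accumulated
power of a multiplies that exponent by α. -/
theorem pow_mul_right (n : ℕ) : a ^ n * b = b * comm a b ^ n * a ^ geomSum α n := by
  induction n with
  | zero => simp [geomSum]
  | succ n ih =>
    have hab : a * b = b * a * comm a b := by simp [comm, mul_assoc]
    calc a ^ (n + 1) * b = a ^ n * b * a * comm a b := by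
          rw [pow_succ, mul_assoc, hab]; simp only [mul_assoc]
      _ = b * comm a b ^ n * (a ^ (geomSum α n + 1) * comm a b) := by
          rw [ih, pow_succ a]; simp only [mul_assoc]
      _ = _ := by
          rw [h.pow_mul_comm, geomSum, pow_succ]; simp only [mul_assoc]

end IsPair

/-- The effect on the exponents `(p, k, i)` of multiplying `bᵖ [a,b]ᵏ aⁱ` by `b` on the right. -/
def step (α : ℕ) (v : ℕ × ℕ × ℕ) : ℕ × ℕ × ℕ :=
  ((v.1 + α ^ v.2.1) % 81, v.2.1 + v.2.2, geomSumMod α v.2.2)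

theorem IsPair.pow_mul_pow {α : ℕ} {a b : G} (h : IsPair (α : ℤ) a b) (i n : ℕ) :
    a ^ i * b ^ n = b ^ ((step α)^[n] (0, 0, i)).1 * comm a b ^ ((step α)^[n] (0, 0, i)).2.1 *
      a ^ ((step α)^[n] (0, 0, i)).2.2 := by
  induction n with
  | zero => simp
  | succ n ih =>
    rw [pow_succ, ← mul_assoc, ih, Function.iterate_succ_apply']
    generalize (step α)^[n] (0, 0, i) = v
    obtain ⟨p, k, i⟩ := v
    -- Exponents of a and b may be reduced modulo 81; that of [a,b] stays exact, as no bound on its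
    -- order is at hand.
    simp only [step]
    rw [mul_assoc, h.pow_mul_right, pow_congr_of_pow_eq_one h.pow_right (Nat.mod_modEq _ _),
      pow_congr_of_pow_eq_one h.pow_left (geomSumMod_modEq α i)]
    have := h.comm_pow_mul_pow 1 k
    rw [mul_one, pow_one] at this
    calc _ = b ^ p * (comm a b ^ k * b) * comm a b ^ i * a ^ geomSum α i := by
          simp only [mul_assoc]
      _ = _ := by
          rw [this, pow_add, pow_add]; simp only [mul_assoc]

/-- The exponents of the two normal forms of `a³ [a,b] b = a³ b^α [a,b]` differ by multiples
of `27`. -/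
theorem step_iterate_collapse : ∀ s < 9,
    let α := 7 + 9 * s
    let v := (step α)^[α] (0, 0, 3)
    v.1 % 81 = (α + 27) % 81 ∧ 3 * α ≤ v.2.1 ∧ (v.2.1 - 3 * α) % 27 = 0 ∧
      α * v.2.2 % 81 = (geomSumMod α (3 * α) + 27) % 81 := by
  decide +kernel

end Macdonald
end

/-! ### A central power and the change of generator -/

section
variable {G : Type*} [Group G]

namespace Macdonald

/-- Comparing the two normal forms of a³b^αc leaves b²⁷c²⁷ᵐa²⁷ = 1, where c = [a,b]. Since c²⁷
commutes with a, so does b²⁷. -/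
theorem IsPair.commute_pow_right {s : ℕ} (hs : s < 9) {a b : G}
    (h : IsPair ((7 + 9 * s : ℕ) : ℤ) a b) : Commute (b ^ 27) a := by
  obtain ⟨hp, hk, hk', hi⟩ := step_iterate_collapse s hs
  -- The first congruence makes [a,b]²⁷ commute with a, the second makes a²⁷ commute with [a,b].
  have hα : (7 + 9 * s) ^ 27 ≡ 1 [MOD 81] ∧ (7 + 9 * s) * 27 ≡ 27 [MOD 81] := by
    have : ∀ s < 9, (7 + 9 * s) ^ 27 ≡ 1 [MOD 81] ∧ (7 + 9 * s) * 27 ≡ 27 [MOD 81] := by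
      decide +kernel
    exact this s hs
  have hv := h.pow_mul_pow 3 (7 + 9 * s)
  generalize (step (7 + 9 * s))^[7 + 9 * s] (0, 0, 3) = v at *
  generalize 7 + 9 * s = α at *
  obtain ⟨p, k, i⟩ := v
  simp only at hp hk hk' hi hv
  obtain ⟨m, hm⟩ := Nat.dvd_of_mod_eq_zero hk'
  obtain rfl : k = 27 * m + 3 * α := by omega
  have hac : Commute a (comm a b ^ 27) := by
    have := h.pow_mul_comm_pow 1 27
    rwa [mul_one, pow_congr_of_pow_eq_one h.pow_left hα.1, pow_one] at this
  have hca : Commute (a ^ 27) (comm a b) := by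
    have := h.pow_mul_comm 27
    rwa [pow_congr_of_pow_eq_one h.pow_left hα.2] at this
  have hleft : a ^ 3 * b ^ α * comm a b
      = b ^ α * b ^ 27 * comm a b ^ (27 * m + 3 * α + 1) * (a ^ 27 * a ^ geomSumMod α (3 * α)) := by
    rw [hv, mul_assoc, h.pow_mul_comm, pow_congr_of_pow_eq_one h.pow_right hp,
      pow_congr_of_pow_eq_one h.pow_left hi, pow_add b, pow_succ _ (27 * m + 3 * α),
      add_comm (geomSumMod _ _), pow_add a]
    simp only [mul_assoc]
  have hright : a ^ 3 * b ^ α * comm a b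
      = b ^ α * comm a b ^ (3 * α + 1) * a ^ geomSumMod α (3 * α) := by
    rw [mul_assoc, ← h.semiconjBy_right.eq, ← mul_assoc, h.pow_mul_comm, mul_comm α 3, mul_assoc,
      h.pow_mul_right, ← mul_assoc, ← mul_assoc, h.semiconjBy_right.eq,
      pow_congr_of_pow_eq_one h.pow_left (geomSumMod_modEq α _), pow_succ']
    simp only [mul_assoc]
  have key : b ^ 27 * (comm a b ^ 27) ^ m * a ^ 27 = 1 := by
    rw [hright, add_assoc (27 * m), pow_add _ (27 * m), pow_mul _ 27 m] at hleft
    have hcomm := (hca.pow_right (3 * α + 1)).eq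
    generalize comm a b ^ (3 * α + 1) = d at *
    apply mul_right_cancel (b := d * a ^ geomSumMod α (3 * α))
    apply mul_left_cancel (a := b ^ α)
    rw [one_mul, ← mul_assoc (b ^ α) d, hleft]
    simp only [mul_assoc]
    rw [← mul_assoc (a ^ 27) d, hcomm, mul_assoc]
  have hb : b ^ 27 = ((comm a b ^ 27) ^ m * a ^ 27)⁻¹ := by
    rw [eq_inv_iff_mul_eq_one, ← mul_assoc, key]
  rw [hb]
  exact (((hac.pow_right m).mul_right ((Commute.refl a).pow_right 27)).inv_right).symm

/-- If `b ^ 27` commutes with `a`, then `b` may be replaced by a power `b ^ t`. -/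
theorem IsPair.pow_right_of_commute {α t m : ℕ} {a b : G} (h : IsPair (α : ℤ) a b)
    (hb : Commute (b ^ 27) a) (hm : t * α ^ t ≡ 27 * m + geomSum α t [MOD 81]) :
    IsPair ((α ^ t : ℕ) : ℤ) a (b ^ t) := by
  -- The factor b²⁷ᵐ commutes with a and b, so conjugation by [a,bᵗ] agrees on both with conjugation
  -- by [a,b]ᵗ.
  have hcomm : comm a (b ^ t) = (b ^ 27) ^ m * comm a b ^ t := by
    have h₁ := h.swap.pow_mul_right t
    have h₂ := h.comm_pow_mul_pow t t
    rw [mul_comm, pow_congr_of_pow_eq_one h.pow_right hm, add_comm, pow_add, pow_mul] at h₂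
    rw [← comm_inv, inv_pow] at h₁
    calc comm a (b ^ t) = (b ^ t * a)⁻¹ * (a * b ^ t) := by simp [comm, mul_assoc]
      _ = (b ^ geomSum α t)⁻¹ * (comm a b ^ t * b ^ t) := by rw [h₁]; group
      _ = _ := by rw [h₂]; group
  have hbm : Commute ((b ^ 27) ^ m) a := hb.pow_left m
  refine ⟨?_, ?_, h.pow_left, by rw [← pow_mul, mul_comm, pow_mul, h.pow_right, one_pow]⟩
  · have h₁ := h.pow_mul_comm_pow 1 t
    rw [pow_one, mul_one] at h₁
    rw [conj, hcomm, zpow_natCast, mul_inv_rev, mul_assoc, mul_assoc, inv_mul_eq_iff_eq_mul, ← h₁,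
      ← mul_assoc a, ← hbm.eq, mul_assoc, inv_mul_cancel_left]
  · have h₁ := h.comm_pow_mul_pow t t
    have h₂ : Commute ((b ^ 27) ^ m) (b ^ (α ^ t * t)) := by
      rw [← pow_mul]; exact Commute.pow_pow_self b _ _
    rw [conj, ← comm_inv, inv_inv, hcomm, zpow_natCast, ← pow_mul b t, mul_comm t, mul_inv_eq_iff_eq_mul,
      mul_assoc, h₁, ← mul_assoc, h₂.eq, mul_assoc]

end Macdonald
end

/-! ### Isomorphisms of the presented groups -/

namespace Macdonald

theorem isPair_of (α : ℤ) :
    IsPair (G := J₃ α) α (PresentedGroup.of 0) (PresentedGroup.of 1) := by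
  have key : ∀ r ∈ relators α, PresentedGroup.mk (relators α) r = 1 :=
    fun r hr => PresentedGroup.one_of_mem hr
  have hx : PresentedGroup.mk (relators α) x = PresentedGroup.of 0 := rfl
  have hy : PresentedGroup.mk (relators α) y = PresentedGroup.of 1 := rfl
  have h₁ := key (conj x (comm x y) * (x ^ α)⁻¹) (by simp [relators])
  have h₂ := key (conj y (comm y x) * (y ^ α)⁻¹) (by simp [relators])
  have h₃ := key (x ^ 81) (by simp [relators])
  have h₄ := key (y ^ 81) (by simp [relators])
  simp only [conj, comm, map_mul, map_inv, map_pow, map_zpow, hx, hy] at h₁ h₂ h₃ h₄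
  exact ⟨mul_inv_eq_one.1 h₁, mul_inv_eq_one.1 h₂, h₃, h₄⟩

/-- The homomorphism from `J₃(α)` sending the generators to a given pair. -/
def IsPair.lift {G : Type*} [Group G] {α : ℤ} {a b : G} (h : IsPair α a b) : J₃ α →* G :=
  PresentedGroup.toGroup (f := ![a, b]) (by
    have hx : FreeGroup.lift ![a, b] x = a := by simp [x]
    have hy : FreeGroup.lift ![a, b] y = b := by simp [y]
    rintro r (rfl | rfl | rfl | rfl)
    · simpa [conj, comm, hx, hy, mul_inv_eq_one] using h.left
    · simpa [conj, comm, hx, hy, mul_inv_eq_one] using h.right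
    · simpa [hx] using h.pow_left
    · simpa [hy] using h.pow_right)

section
variable {G : Type*} [Group G] {α : ℤ} {a b : G} (h : IsPair α a b)

@[simp] theorem IsPair.lift_of_zero : h.lift (PresentedGroup.of 0) = a := by
  simp [IsPair.lift]

@[simp] theorem IsPair.lift_of_one : h.lift (PresentedGroup.of 1) = b := by
  simp [IsPair.lift]

end

/-- If passing to the pairs `(x, y ^ t)` and `(x, y ^ u)` exchanges the relations for `α` and `β`,
with `t` and `u` inverse to each other modulo `81`, then `J₃(α) ≅ J₃(β)`. -/
def equivOfPow {α β : ℤ} {t u : ℕ} (htu : t * u ≡ 1 [MOD 81])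
    (hα : IsPair (G := J₃ α) β (PresentedGroup.of 0) (PresentedGroup.of 1 ^ t))
    (hβ : IsPair (G := J₃ β) α (PresentedGroup.of 0) (PresentedGroup.of 1 ^ u)) :
    J₃ α ≃* J₃ β :=
  MonoidHom.toMulEquiv hβ.lift hα.lift
    (PresentedGroup.ext fun i => by
      fin_cases i
      · simp
      · simpa [← pow_mul] using pow_congr_of_pow_eq_one (isPair_of α).pow_right htu)
    (PresentedGroup.ext fun i => by
      fin_cases i
      · simp
      · simpa [← pow_mul, mul_comm u t] using
          pow_congr_of_pow_eq_one (isPair_of β).pow_right htu)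

/-- Each `7 + 9s` is a power `7 ^ t` modulo `81` with `t ≡ 1` modulo `3`. -/
theorem exists_exponents : ∀ s < 9, ∃ t < 81, ∃ u < 81, t * u % 81 = 1 ∧
    7 ^ t % 81 = (7 + 9 * s) % 81 ∧ (7 + 9 * s) ^ u % 81 = 7 ∧
    (∃ m < 3, t * 7 ^ t % 81 = (27 * m + geomSumMod 7 t) % 81) ∧
    ∃ m < 3, u * (7 + 9 * s) ^ u % 81 = (27 * m + geomSumMod (7 + 9 * s) u) % 81 := by
  decide +kernel

theorem nonempty_J₃_equiv {α : ℤ} (hα : α ≡ 7 [ZMOD 9]) : Nonempty (J₃ α ≃* J₃ 7) := by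
  obtain ⟨s, hs, hαs⟩ : ∃ s < 9, α ≡ ((7 + 9 * s : ℕ) : ℤ) [ZMOD 81] := by
    -- Only α modulo 81 matters, so (α - 7)/9 is needed only modulo 9.
    refine ⟨((α - 7) / 9 % 9).toNat, ?_, ?_⟩ <;> simp only [Int.ModEq] at * <;> omega
  obtain ⟨t, -, u, -, htu, ht, hu, ⟨m, -, hm⟩, n, -, hn⟩ := exists_exponents s hs
  have h₇ : IsPair ((7 : ℕ) : ℤ) (PresentedGroup.of 0 : J₃ 7) (PresentedGroup.of 1) := isPair_of 7
  have h := (isPair_of α).congr hαs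
  have hm' : t * 7 ^ t ≡ 27 * m + geomSum 7 t [MOD 81] :=
    Nat.ModEq.trans hm ((geomSumMod_modEq 7 t).add_left _)
  have hn' : u * (7 + 9 * s) ^ u ≡ 27 * n + geomSum (7 + 9 * s) u [MOD 81] :=
    Nat.ModEq.trans hn ((geomSumMod_modEq _ u).add_left _)
  have h₇' := (h₇.pow_right_of_commute (IsPair.commute_pow_right (s := 0) (by norm_num) h₇)
    hm').congr ((Int.natCast_modEq_iff.2 ht).trans hαs.symm)
  have h' := (h.pow_right_of_commute (IsPair.commute_pow_right hs h) hn').congr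
    (Int.natCast_modEq_iff.2 (show _ ≡ 7 [MOD 81] from hu))
  exact ⟨equivOfPow (mul_comm t u ▸ htu) h' h₇'⟩

theorem map_upperCentralSeries_equiv {G H : Type*} [Group G] [Group H] (e : G ≃* H) (n : ℕ) :
    (Subgroup.upperCentralSeries G n).map (e : G →* H) = Subgroup.upperCentralSeries H n := by
  rw [← Subgroup.comap_upperCentralSeries e]
  exact Subgroup.map_comap_eq_self_of_surjective e.surjective _

end Macdonald

theorem theoremC (ℓ : ℤ) (hℓ : ℓ ≡ -1 [ZMOD 3]) :
    Nonempty (Macdonald.J₃ (1 + 3 * ℓ) ≃* Macdonald.J₃ 7) ∧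
    Nonempty (Macdonald.H₃ (1 + 3 * ℓ) ≃* Macdonald.H₃ 7) ∧
    Nonempty (Macdonald.K₃ (1 + 3 * ℓ) ≃* Macdonald.K₃ 7) := by
  -- From ℓ ≡ -1 mod 3 it follows that 1 + 3ℓ ≡ -2 ≡ 7 mod 9.
  obtain ⟨e⟩ := Macdonald.nonempty_J₃_equiv (α := 1 + 3 * ℓ) (by
    simp only [Int.ModEq] at *; omega)
  have h := Macdonald.map_upperCentralSeries_equiv e
  have h₁ := h 1
  rw [Subgroup.upperCentralSeries_one, Subgroup.upperCentralSeries_one] at h₁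
  exact ⟨⟨e⟩, ⟨QuotientGroup.congr _ _ e h₁⟩, ⟨QuotientGroup.congr _ _ e (h 2)⟩⟩
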